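/- **Theorem (Monotonicity of channel mana).** All systems are finite-dimensional and are tensor products of qudits of odd prime dimension (the trivial one-dimensional system is allowed). For a qudit of odd prime dimension $d$ put $\omega=e^{2\pi i/d}$, $\tau=e^{(d+1)\pi i/d}$, $X|j\rangle=|j+1 \bmod d\rangle$, $Z|j\rangle=\omega^j|j\rangle$, and $T_{\boldsymbol u}=\tau^{-a_1a_2}Z^{a_1}X^{a_2}$ for $\boldsymbol u=(a_1,a_2)\in\mathbb Z_d\times\mathbb Z_d$. On a composite system the phase space is the product of the phase spaces and $T_{\boldsymbol u\oplus\boldsymbol v}=T_{\boldsymbol u}\otimes T_{\boldsymbol v}$. On a system $A$ of dimension $d_A$ put $A_A^{\boldsymbol 0}=\frac1{d_A}\sum_{\boldsymbol u}T_{\boldsymbol u}$ and $A_A^{\boldsymbol u}=T_{\boldsymbol u}A_A^{\boldsymbol 0}T_{\boldsymbol u}^\dagger$. The discrete Wigner function of an operator $Q$ on $A$ is $W_Q(\boldsymbol u)=\frac1{d_A}\operatorname{Tr}[A_A^{\boldsymbol u}Q]$, and that of a linear map $\mathcal N_{A\to B}$ on operators is $$W_{\mathcal N}(\boldsymbol v|\boldsymbol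 u)=\frac1{d_B}\operatorname{Tr}\big[A_B^{\boldsymbol v}\,\mathcal N(A_A^{\boldsymbol u})\big].$$ The mana of $\mathcal N$ is $\mathcal M(\mathcal N)=\log\max_{\boldsymbol u}\sum_{\boldsymbol v}|W_{\mathcal N}(\boldsymbol v|\boldsymbol u)|$, with $\log 0=-\infty$. A quantum channel is a completely positive trace-preserving linear map. A Hermiticity-preserving linear map $\Pi_{A\to B}$ is *completely positive Wigner preserving* (CPWP) if, for every system $R$, $\operatorname{id}_R\otimes\Pi$ takes every density operator on $RA$ with non-negative discrete Wigner function to a density operator on $RB$ with non-negative discrete Wigner function. A *superchannel* $\Xi_{(A\to B)\to(C\to D)}$ is a linear map from linear maps $A\to B$ to linear maps $C\to D$ (acting on operators) such that, for every finite-dimensional reference system $R$ and every quantum channel $\mathcal N_{RA\to RB}$, the map $(\operatorname{id}_R\otimes\Xi)(\mathcal N)_{RC\to RD}$ is a quantum channel, where $\operatorname{id}_R$ is the identity supermap. It is a *CPWP superchannel* if, moreover, for every system $R$ and every CPWP quantum channel $\mathcal N_{RA\to RB}$, the channel $(\operatorname{id}_R\otimes\Xi)(\mathcal N)$ is CPWP.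 Let $\Xi_{(A\to B)\to(C\to D)}$ be a CPWP superchannel. Then for every completely positive map $\mathcal N_{A\to B}$, trace preserving or not (in particular, for every quantum channel), $$\mathcal M(\mathcal N)\ \ge\ \mathcal M(\Xi(\mathcal N)).$$ -/

import Mathlib

open scoped ComplexOrder Kronecker

noncomputable section

/-- A finite-dimensional quantum system of odd dimension, presented as a tensor product of systems
of odd prime dimension. The empty tensor product, of dimension one, is `unit`. -/
inductive QSys : Type
  | unit : QSys
  | qudit (p : ℕ) (hp : p.Prime) (hodd : Odd p) : QSys
  | tensor (A B : QSys) : QSys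

namespace QSys

/-- Labels of the computational basis: `ZMod p` for a qudit of dimension `p`, and pairs for a
tensor product. -/
def Idx : QSys → Type
  | unit => Unit
  | qudit p _ _ => ZMod p
  | tensor A B => A.Idx × B.Idx

/-- The discrete phase space: `ZMod p × ZMod p` for a qudit of dimension `p`, and pairs of
phase-space points for a tensor product. -/
def Phase : QSys → Type
  | unit => Unit
  | qudit p _ _ => ZMod p × ZMod p
  | tensor A B => A.Phase × B.Phase

instance instFintypeIdx : (A : QSys) → Fintype A.Idx
  | unit => inferInstanceAs (Fintype Unit)
  | qudit p hp _ =>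
      haveI : NeZero p := ⟨hp.ne_zero⟩
      inferInstanceAs (Fintype (ZMod p))
  | tensor A B =>
      haveI := instFintypeIdx A
      haveI := instFintypeIdx B
      inferInstanceAs (Fintype (A.Idx × B.Idx))

instance instDecidableEqIdx : (A : QSys) → DecidableEq A.Idx
  | unit => inferInstanceAs (DecidableEq Unit)
  | qudit p _ _ => inferInstanceAs (DecidableEq (ZMod p))
  | tensor A B =>
      haveI := instDecidableEqIdx A
      haveI := instDecidableEqIdx B
      inferInstanceAs (DecidableEq (A.Idx × B.Idx))

instance instFintypePhase : (A : QSys) → Fintype A.Phase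
  | unit => inferInstanceAs (Fintype Unit)
  | qudit p hp _ =>
      haveI : NeZero p := ⟨hp.ne_zero⟩
      inferInstanceAs (Fintype (ZMod p × ZMod p))
  | tensor A B =>
      haveI := instFintypePhase A
      haveI := instFintypePhase B
      inferInstanceAs (Fintype (A.Phase × B.Phase))

/-- The origin of the phase space. -/
def origin : (A : QSys) → A.Phase
  | unit => ()
  | qudit p _ _ => ((0, 0) : ZMod p × ZMod p)
  | tensor A B => (A.origin, B.origin)

instance instNonemptyPhase (A : QSys) : Nonempty A.Phase := ⟨A.origin⟩

/-- The dimension of the Hilbert space. -/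
def dim (A : QSys) : ℕ := Fintype.card A.Idx

/-- Operators on the Hilbert space, as matrices in the computational basis. -/
abbrev Op (A : QSys) : Type := Matrix A.Idx A.Idx ℂ

end QSys

open QSys

/-! ### Heisenberg--Weyl and phase-space point operators -/

/-- The shift operator `X |j⟩ = |j + 1⟩`. -/
def shiftOp (p : ℕ) : Matrix (ZMod p) (ZMod p) ℂ :=
  Matrix.of fun k j => if k = j + 1 then 1 else 0

/-- The boost operator `Z |j⟩ = ω ^ j |j⟩`, with `ω = exp (2 π i / p)`. -/
def boostOp (p : ℕ) : Matrix (ZMod p) (ZMod p) ℂ :=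
  Matrix.diagonal fun j => Complex.exp (2 * Real.pi * Complex.I / p) ^ j.val

/-- The Heisenberg--Weyl operators: `τ ^ (-a₁ a₂) Z ^ a₁ X ^ a₂`, with `τ = exp ((p + 1) π i / p)`,
on a qudit of dimension `p`, and tensor products of these on a composite system. -/
def heisenbergWeyl : (A : QSys) → A.Phase → A.Op
  | unit => fun _ => (1 : Matrix Unit Unit ℂ)
  | qudit p hp _ => fun a : ZMod p × ZMod p =>
      haveI : NeZero p := ⟨hp.ne_zero⟩
      (Complex.exp ((p + 1) * Real.pi * Complex.I / p) ^ (-((a.1.val : ℤ) * (a.2.val : ℤ))) •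
        (boostOp p ^ a.1.val * shiftOp p ^ a.2.val) : Matrix (ZMod p) (ZMod p) ℂ)
  | tensor A B => fun u : A.Phase × B.Phase =>
      (heisenbergWeyl A u.1 ⊗ₖ heisenbergWeyl B u.2 :
        Matrix (A.Idx × B.Idx) (A.Idx × B.Idx) ℂ)

/-- The phase-space point operator at the origin, `(1 / d) ∑ u, T u`. -/
def phaseOpZero (A : QSys) : A.Op := (1 / (A.dim : ℂ)) • ∑ u : A.Phase, heisenbergWeyl A u

/-- The phase-space point operators `T u * A 0 * (T u)†`. -/
def phaseOp (A : QSys) (u : A.Phase) : A.Op :=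
  heisenbergWeyl A u * phaseOpZero A * (heisenbergWeyl A u).conjTranspose

/-- The discrete Wigner function `(1 / d) Tr[A u * X]`. It takes real values when `X` is
Hermitian. -/
def wigner (A : QSys) (X : A.Op) (u : A.Phase) : ℂ :=
  (1 / (A.dim : ℂ)) * (phaseOp A u * X).trace

/-- Membership in the Wigner polytope: density operators with non-negative discrete Wigner
function. The order on `ℂ` is the one in which `0 ≤ z` says that `z` is real and non-negative. -/
def IsWignerPositiveState (A : QSys) (ρ : A.Op) : Prop :=
  ρ.PosSemidef ∧ ρ.trace = 1 ∧ ∀ u, 0 ≤ wigner A ρ u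

/-! ### Maps, channels and supermaps -/

section Maps

variable {α β γ δ : Type}

/-- The block `⟨r|M|s⟩` of an operator `M` on a bipartite system. -/
def blockAt {ρ : Type} (M : Matrix (ρ × α) (ρ × α) ℂ) (r s : ρ) : Matrix α α ℂ :=
  Matrix.of fun a a' => M (r, a) (s, a')

/-- The map `id ⊗ Φ`, where the identity acts on the operators of a reference system with basis
labels `ρ`: it applies `Φ` to every block. -/
def idTensor (ρ : Type) (Φ : Matrix α α ℂ →ₗ[ℂ] Matrix β β ℂ) :
    Matrix (ρ × α) (ρ × α) ℂ →ₗ[ℂ] Matrix (ρ × β) (ρ × β) ℂ where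
  toFun M := Matrix.of fun x y => Φ (blockAt M x.1 y.1) x.2 y.2
  map_add' M M' := by
    ext x y
    have h : blockAt (M + M') x.1 y.1 = blockAt M x.1 y.1 + blockAt M' x.1 y.1 := rfl
    simp [h]
  map_smul' c M := by
    ext x y
    have h : blockAt (c • M) x.1 y.1 = c • blockAt M x.1 y.1 := rfl
    simp [h]

/-- Complete positivity: `id ⊗ Φ` preserves positive semidefiniteness for every finite-dimensional
reference system. -/
def IsCompletelyPositive (Φ : Matrix α α ℂ →ₗ[ℂ] Matrix β β ℂ) : Prop :=
  ∀ (n : ℕ) (M : Matrix (Fin n × α) (Fin n × α) ℂ),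
    M.PosSemidef → (idTensor (Fin n) Φ M).PosSemidef

/-- Trace preservation. -/
def IsTracePreserving [Fintype α] [Fintype β] (Φ : Matrix α α ℂ →ₗ[ℂ] Matrix β β ℂ) : Prop :=
  ∀ M, (Φ M).trace = M.trace

/-- A quantum channel is a completely positive and trace-preserving linear map. -/
def IsChannel [Fintype α] [Fintype β] (Φ : Matrix α α ℂ →ₗ[ℂ] Matrix β β ℂ) : Prop :=
  IsCompletelyPositive Φ ∧ IsTracePreserving Φ

/-- Preservation of Hermitian operators. -/
def IsHermiticityPreserving (Φ : Matrix α α ℂ →ₗ[ℂ] Matrix β β ℂ) : Prop :=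
  ∀ M : Matrix α α ℂ, M.IsHermitian → (Φ M).IsHermitian

variable {ρ : Type} [DecidableEq ρ]

/-- The component `X ↦ ⟨s|N(|r⟩⟨r'| ⊗ X)|s'⟩` of a bipartite map `N`, so that
`N (Y ⊗ X) = ∑ r r' s s', Y r r' • (|s⟩⟨s'| ⊗ mapSlice N r r' s s' X)`. -/
def mapSlice (N : Matrix (ρ × α) (ρ × α) ℂ →ₗ[ℂ] Matrix (ρ × β) (ρ × β) ℂ) (r r' s s' : ρ) :
    Matrix α α ℂ →ₗ[ℂ] Matrix β β ℂ where
  toFun X := blockAt (N (Matrix.single r r' (1 : ℂ) ⊗ₖ X)) s s'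
  map_add' X Y := by
    rw [Matrix.kronecker_add, map_add]
    rfl
  map_smul' c X := by
    rw [Matrix.kronecker_smul, map_smul]
    rfl

/-- The supermap `id ⊗ Ξ`, where `id` is the identity supermap on a reference system with basis
labels `ρ`: it applies `Ξ` to every component of a bipartite map. -/
def idTensorSuper [Fintype ρ]
    (Ξ : (Matrix α α ℂ →ₗ[ℂ] Matrix β β ℂ) →ₗ[ℂ] (Matrix γ γ ℂ →ₗ[ℂ] Matrix δ δ ℂ))
    (N : Matrix (ρ × α) (ρ × α) ℂ →ₗ[ℂ] Matrix (ρ × β) (ρ × β) ℂ) :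
    Matrix (ρ × γ) (ρ × γ) ℂ →ₗ[ℂ] Matrix (ρ × δ) (ρ × δ) ℂ where
  toFun M := Matrix.of fun x y =>
    ∑ r : ρ, ∑ r' : ρ, Ξ (mapSlice N r r' x.1 y.1) (blockAt M r r') x.2 y.2
  map_add' M M' := by
    ext x y
    have h : ∀ r r', blockAt (M + M') r r' = blockAt M r r' + blockAt M' r r' :=
      fun _ _ => rfl
    simp [h, Finset.sum_add_distrib]
  map_smul' c M := by
    ext x y
    have h : ∀ r r', blockAt (c • M) r r' = c • blockAt M r r' := fun _ _ => rfl
    simp [h, Finset.mul_sum]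

end Maps

/-- Linear maps from the operators on `A` to the operators on `B`. -/
abbrev QMap (A B : QSys) : Type := A.Op →ₗ[ℂ] B.Op

/-- Linear supermaps, taking maps from `A` to `B` to maps from `C` to `D`. -/
abbrev QSuperMap (A B C D : QSys) : Type := QMap A B →ₗ[ℂ] QMap C D

/-- A superchannel is a linear supermap `Ξ` such that `id ⊗ Ξ` takes bipartite channels to
channels, for every finite-dimensional reference system. -/
def IsSuperchannel {A B C D : QSys} (Ξ : QSuperMap A B C D) : Prop :=
  ∀ (n : ℕ) (N : Matrix (Fin n × A.Idx) (Fin n × A.Idx) ℂ →ₗ[ℂ]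
      Matrix (Fin n × B.Idx) (Fin n × B.Idx) ℂ),
    IsChannel N → IsChannel (idTensorSuper Ξ N)

/-- Completely positive-Wigner-preserving maps: Hermiticity-preserving linear maps `Φ` such that,
for every reference system `R`, the map `id ⊗ Φ` takes states with non-negative discrete Wigner
function to states with non-negative discrete Wigner function. -/
def IsCPWP {A B : QSys} (Φ : QMap A B) : Prop :=
  IsHermiticityPreserving Φ ∧
    ∀ (R : QSys) (ρ : (R.tensor A).Op), IsWignerPositiveState (R.tensor A) ρ →
      IsWignerPositiveState (R.tensor B) (idTensor R.Idx Φ ρ)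

/-- The supermap `id ⊗ Ξ` for a reference system `R`. -/
def refSuper (R : QSys) {A B C D : QSys} (Ξ : QSuperMap A B C D)
    (N : QMap (R.tensor A) (R.tensor B)) : QMap (R.tensor C) (R.tensor D) :=
  idTensorSuper (ρ := R.Idx) Ξ N

/-- CPWP superchannels: superchannels `Ξ` such that, for every reference system `R`, the supermap
`id ⊗ Ξ` takes CPWP channels to CPWP channels. (That the output is a channel is part of `Ξ` being
a superchannel.) -/
def IsCPWPSuperchannel {A B C D : QSys} (Ξ : QSuperMap A B C D) : Prop :=
  IsSuperchannel Ξ ∧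
    ∀ (R : QSys) (N : QMap (R.tensor A) (R.tensor B)),
      IsChannel N → IsCPWP N → IsCPWP (refSuper R Ξ N)

/-! ### Mana -/

/-- The discrete Wigner function of a map, `W(v|u) = (1 / d_B) Tr[A v * N (A u)]`. -/
def wignerMap {A B : QSys} (N : QMap A B) (v : B.Phase) (u : A.Phase) : ℂ :=
  (1 / (B.dim : ℂ)) * (phaseOp B v * N (phaseOp A u)).trace

/-- The mana `log max_u ∑ v, |W(v|u)|` of a map (natural logarithm). It is an extended real, since
the zero map has mana `log 0 = -∞`. -/
def mana {A B : QSys} (N : QMap A B) : EReal :=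
  ENNReal.log (ENNReal.ofReal (⨆ u : A.Phase, ∑ v : B.Phase, ‖wignerMap N v u‖))

end

noncomputable section

open QSys

/-! The phase-space point operators are Hermitian, have trace one and square to the identity; their
pairwise products have non-negative trace, their transposes are again point operators, and they form
a basis dual to itself up to the factor `d`. These facts are checked on one qudit with additive
characters and pass to tensor products (`isPhaseFrame_phaseOp`).

By linearity, `Ξ` therefore acts on Wigner functions through a kernel (`wignerMap_supermap`): the
value of `Ξ N` at `(t|w)` is the sum over `u, v` of the value of `N` at `(v|u)` times the kernel
`wignerMap (Ξ (transitionMap v u)) t w`. Two properties of the kernel suffice.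

Normalization: a superchannel sends channels to trace-preserving maps. Testing this on
measure-and-prepare channels shows that the sum of the kernel over `t` does not depend on `v`, and
that summing this further over `u` gives one.

Positivity: apply `id ⊗ Ξ` to a single CPWP channel, the exchange channel with reference `A ⊗ B`. It
stores the input of `A` in the reference and feeds the stored `B` to the output, so point operators
inserted and measured on the reference select each `transitionMap v u` up to a positive factor. CPWP
maps have non-negative Wigner functions (`IsCPWP.wignerMap_nonneg`), hence so does the kernel.

The triangle inequality then bounds each column sum of `Ξ N` by a convex combination of column sums
of `N`, hence by their maximum (`IsSuperchannel.mana_le`). -/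

/-- The algebraic properties of a family of phase-space point operators. -/
structure IsPhaseFrame {ι κ : Type} [Fintype ι] [DecidableEq ι] [Fintype κ]
    (F : κ → Matrix ι ι ℂ) : Prop where
  isHermitian : ∀ u, (F u).IsHermitian
  trace_eq : ∀ u, (F u).trace = 1
  mul_self : ∀ u, F u * F u = 1
  trace_mul_nonneg : ∀ u v, 0 ≤ (F u * F v).trace
  transpose_mem : ∀ u, ∃ v, F v = (F u).transpose
  -- In tensor form: the sum of `F u ⊗ F u` is `d` times the swap operator.
  complete : ∀ i j k l, ∑ u, F u i j * F u k l =
    (Fintype.card ι : ℂ) * ((if i = l then 1 else 0) * (if j = k then 1 else 0))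

/-! ### A single qudit -/

section Qudit

variable {p : ℕ}

/-- For odd `p` the residue of `(p + 1) / 2` is the inverse of two. It is also the exponent for
which `τ` is a power of `ω`. -/
lemma half_add_half (hodd : Odd p) :
    (((p + 1) / 2 : ℕ) : ZMod p) + (((p + 1) / 2 : ℕ) : ZMod p) = 1 := by
  obtain ⟨m, hm⟩ := hodd
  have h : (p + 1) / 2 + (p + 1) / 2 = p + 1 := by omega
  rw [← Nat.cast_add, h]
  simp

lemma add_eq_zero_iff_half (hodd : Odd p) (k j : ZMod p) :
    k - (((p + 1) / 2 : ℕ) : ZMod p) * (k - j) = 0 ↔ k + j = 0 := by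
  have h := half_add_half hodd
  set c := (((p + 1) / 2 : ℕ) : ZMod p)
  constructor <;> intro h'
  · linear_combination 2 * h' + (k - j) * h
  · linear_combination c * h' - k * h

lemma add_self_inj (hodd : Odd p) {x y : ZMod p} : x + x = y + y ↔ x = y := by
  have h := half_add_half hodd
  refine ⟨fun h' => ?_, fun h' => by rw [h']⟩
  linear_combination (((p + 1) / 2 : ℕ) : ZMod p) * h' - (x - y) * h

variable [NeZero p]

lemma boostOp_pow (n : ℕ) :
    boostOp p ^ n = Matrix.diagonal fun j : ZMod p => ZMod.stdAddChar ((n : ZMod p) * j) := by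
  rw [boostOp, Matrix.diagonal_pow]
  congr 1
  ext j
  rw [Pi.pow_apply, ← nsmul_eq_mul, AddChar.map_nsmul_eq_pow, ← Complex.exp_nat_mul]
  congr 1
  rw [ZMod.stdAddChar_apply, ZMod.toCircle_apply]
  congr 1
  ring

lemma shiftOp_pow (n : ℕ) :
    shiftOp p ^ n = Matrix.of fun k j : ZMod p => if k = j + n then (1 : ℂ) else 0 := by
  induction n with
  | zero => ext k j; simp [Matrix.one_apply]
  | succ n ih =>
    rw [pow_succ, ih]
    ext k j
    simp [Matrix.mul_apply, shiftOp, add_assoc, add_comm (1 : ZMod p)]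

/-- The square root `exp ((p + 1) π i / p)` of the root of unity, as a value of a character. -/
lemma exp_half_eq (hodd : Odd p) :
    Complex.exp ((p + 1) * Real.pi * Complex.I / p) =
      ZMod.stdAddChar ((((p + 1) / 2 : ℕ) : ℕ) : ZMod p) := by
  have hp : (p : ℂ) ≠ 0 := NeZero.ne _
  obtain ⟨m, rfl⟩ := hodd
  have h : (2 * m + 1 + 1) / 2 = m + 1 := by omega
  rw [h]
  have := ZMod.stdAddChar_coe (N := 2 * m + 1) (m + 1 : ℤ)
  push_cast at this ⊢
  rw [this]
  congr 1
  push_cast at hp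
  field_simp
  ring


/-- The entries of the phase-space point operators of a qudit. -/
def quditPoint (p : ℕ) [NeZero p] (a : ZMod p × ZMod p) : Matrix (ZMod p) (ZMod p) ℂ :=
  Matrix.of fun k j => if k + j = a.2 + a.2 then ZMod.stdAddChar (a.1 * (k - j)) else 0

lemma star_stdAddChar (x : ZMod p) :
    star (ZMod.stdAddChar x : ℂ) = ZMod.stdAddChar (-x) := by
  rw [ZMod.stdAddChar_apply, ZMod.stdAddChar_apply, AddChar.map_neg_eq_inv,
    Circle.coe_inv_eq_conj]
  rfl

lemma sum_stdAddChar_mul (b : ZMod p) :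
    ∑ x : ZMod p, (ZMod.stdAddChar (x * b) : ℂ) = (p : ℂ) * if b = 0 then 1 else 0 := by
  rw [AddChar.sum_mulShift b (ZMod.isPrimitive_stdAddChar p), ZMod.card]
  split_ifs <;> simp

/-- The Heisenberg--Weyl operators of a qudit, by their entries. -/
def quditWeyl (p : ℕ) [NeZero p] (a : ZMod p × ZMod p) : Matrix (ZMod p) (ZMod p) ℂ :=
  Matrix.of fun k j => if k = j + a.2 then
    ZMod.stdAddChar (a.1 * (k - (((p + 1) / 2 : ℕ) : ZMod p) * a.2)) else 0

/-- The parity operator of a qudit. -/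
def quditParity (p : ℕ) : Matrix (ZMod p) (ZMod p) ℂ :=
  Matrix.of fun k j => if k + j = 0 then 1 else 0

/-- Since `τ` is itself a `p`-th root of unity, all exponents matter only modulo `p`, and the
representatives `val` disappear. -/
lemma heisenbergWeyl_qudit (hp : p.Prime) (hodd : Odd p) :
    heisenbergWeyl (qudit p hp hodd) = quditWeyl p := by
  funext a
  change Complex.exp ((p + 1) * Real.pi * Complex.I / p) ^ (-((a.1.val : ℤ) * (a.2.val : ℤ))) •
        (boostOp p ^ a.1.val * shiftOp p ^ a.2.val) = quditWeyl p a
  rw [exp_half_eq hodd, boostOp_pow, shiftOp_pow, ← AddChar.map_zsmul_eq_zpow]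
  ext k j
  rw [Matrix.smul_apply, Matrix.diagonal_mul]
  simp only [quditWeyl, Matrix.of_apply, ZMod.natCast_zmod_val, smul_eq_mul]
  split_ifs
  · rw [mul_one, ← AddChar.map_add_eq_mul]
    congr 1
    rw [zsmul_eq_mul]
    push_cast
    simp only [ZMod.natCast_zmod_val]
    ring
  · simp

/-- An entry fixes `a.2 = k - j`; the character sum over `a.1` then forces `k - (k - j) / 2 = (k +
j) / 2` to vanish. -/
lemma sum_quditWeyl (hodd : Odd p) :
    (1 / (Fintype.card (ZMod p) : ℂ)) • ∑ a, quditWeyl p a = quditParity p := by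
  have hp0 : (p : ℂ) ≠ 0 := NeZero.ne _
  ext k j
  have h2 : ∀ b : ZMod p, (k = j + b) ↔ (b = k - j) := fun b =>
    ⟨fun h => by rw [h]; ring, fun h => by rw [h]; ring⟩
  simp only [quditWeyl, quditParity, Matrix.smul_apply, Matrix.sum_apply, Matrix.of_apply,
    Fintype.sum_prod_type, h2, Finset.sum_ite_eq', Finset.mem_univ, if_true,
    sum_stdAddChar_mul, ZMod.card, add_eq_zero_iff_half hodd, smul_eq_mul]
  field_simp

lemma phaseOpZero_qudit (hp : p.Prime) (hodd : Odd p) :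
    phaseOpZero (qudit p hp hodd) = quditParity p := by
  rw [phaseOpZero, heisenbergWeyl_qudit, ← sum_quditWeyl hodd]
  rfl

lemma quditWeyl_conj_parity (a : ZMod p × ZMod p) :
    quditWeyl p a * quditParity p * (quditWeyl p a).conjTranspose = quditPoint p a := by
  ext k j
  have h2 : ∀ k b : ZMod p, (k = b + a.2) ↔ (b = k - a.2) := fun k b =>
    ⟨fun h => by rw [h]; ring, fun h => by rw [h]; ring⟩
  have h3 : k - a.2 + (j - a.2) = 0 ↔ k + j = a.2 + a.2 :=
    ⟨fun h => by linear_combination h, fun h => by linear_combination h⟩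
  simp only [Matrix.mul_apply, Matrix.of_apply, Matrix.conjTranspose_apply, quditWeyl,
    quditParity, h2, apply_ite star, star_zero, ite_mul, zero_mul,
    Finset.sum_ite_eq', Finset.mem_univ, if_true, star_stdAddChar]
  simp only [mul_ite, mul_zero, Finset.sum_ite_eq', Finset.mem_univ, if_true, h3, mul_one,
    quditPoint, Matrix.of_apply, ite_mul, zero_mul]
  split_ifs
  · rw [← AddChar.map_add_eq_mul]
    congr 1
    ring
  · rfl

lemma phaseOp_qudit (hp : p.Prime) (hodd : Odd p) :
    phaseOp (qudit p hp hodd) = quditPoint p := by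
  funext a
  rw [phaseOp, phaseOpZero_qudit, heisenbergWeyl_qudit]
  exact quditWeyl_conj_parity a

lemma isPhaseFrame_quditPoint (hodd : Odd p) : IsPhaseFrame (quditPoint p) where
  isHermitian a := by
    ext k j
    simp only [Matrix.conjTranspose_apply, quditPoint, Matrix.of_apply, add_comm j k,
      apply_ite star, star_zero, star_stdAddChar]
    congr 2
    ring
  trace_eq a := by
    simp [Matrix.trace, quditPoint, add_self_inj hodd]
  mul_self a := by
    ext k j
    have h2 : ∀ x, k + x = a.2 + a.2 ↔ x = a.2 + a.2 - k := fun x =>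
      ⟨fun h => by linear_combination h, fun h => by linear_combination h⟩
    have h3 : a.2 + a.2 - k + j = a.2 + a.2 ↔ k = j :=
      ⟨fun h => by linear_combination -h, fun h => by linear_combination -h⟩
    simp only [Matrix.mul_apply, quditPoint, Matrix.of_apply, Matrix.one_apply, h2, ite_mul,
      zero_mul, Finset.sum_ite_eq', Finset.mem_univ, if_true, h3]
    simp only [mul_ite, mul_zero]
    split_ifs with h
    · rw [← AddChar.map_add_eq_mul, h, ← AddChar.map_zero_eq_one (ZMod.stdAddChar (N := p))]
      congr 1
      ring
    · rfl
  trace_mul_nonneg a b := by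
    have h2 : ∀ k x, k + x = a.2 + a.2 ↔ x = a.2 + a.2 - k := fun k x =>
      ⟨fun h => by linear_combination h, fun h => by linear_combination h⟩
    have h3 : ∀ k, a.2 + a.2 - k + k = b.2 + b.2 ↔ a.2 = b.2 := fun k => by
      rw [sub_add_cancel, add_self_inj hodd]
    simp only [Matrix.trace, Matrix.diag_apply, Matrix.mul_apply, quditPoint, Matrix.of_apply, h2,
      ite_mul, zero_mul, Finset.sum_ite_eq', Finset.mem_univ, if_true, h3]
    simp only [mul_ite, mul_zero]
    split_ifs with h
    -- With equal positions the phases form a character of `k` of frequency `2 * (a.1 - b.1)`. The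
    -- trace is thus `p` when `a = b` and zero otherwise.
    · have h4 : ∀ k : ZMod p, (ZMod.stdAddChar (a.1 * (k - (a.2 + a.2 - k))) *
          ZMod.stdAddChar (b.1 * (a.2 + a.2 - k - k)) : ℂ) =
          ZMod.stdAddChar ((a.1 - b.1) * (-(2 * a.2))) *
            ZMod.stdAddChar (k * (2 * (a.1 - b.1))) := fun k => by
        rw [← AddChar.map_add_eq_mul, ← AddChar.map_add_eq_mul]
        congr 1
        ring
      simp only [h4, ← Finset.mul_sum, sum_stdAddChar_mul]
      split_ifs with h5
      · have h6 : a.1 - b.1 = 0 := by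
          rw [← add_self_inj hodd]
          linear_combination h5
        simp [h6]
      · simp
    · simp
  transpose_mem a := by
    refine ⟨(-a.1, a.2), ?_⟩
    ext k j
    simp only [Matrix.transpose_apply, quditPoint, Matrix.of_apply, add_comm j k]
    congr 2
    ring
  complete i j k l := by
    have hh := half_add_half hodd
    -- Only the midpoint of `i` and `j` contributes to the sum over positions. The sum over momenta
    -- then gives `i - j + k - l = 0`, which together with `k + l = i + j` leaves `i = l` and `j =
    -- k`.
    have h2 : ∀ x : ZMod p, i + j = x + x ↔ x = (((p + 1) / 2 : ℕ) : ZMod p) * (i + j) :=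
      fun x => ⟨fun h => by linear_combination -(((p + 1) / 2 : ℕ) : ZMod p) * h - x * hh,
        fun h => by linear_combination -2 * h - (i + j) * hh⟩
    have h3 : k + l = (((p + 1) / 2 : ℕ) : ZMod p) * (i + j) +
        (((p + 1) / 2 : ℕ) : ZMod p) * (i + j) ↔ k + l = i + j := by
      rw [← add_mul, hh, one_mul]
    simp only [quditPoint, Matrix.of_apply, Fintype.sum_prod_type, h2, ite_mul, zero_mul,
      Finset.sum_ite_eq', Finset.mem_univ, if_true, h3]
    simp only [mul_ite, mul_zero, ← AddChar.map_add_eq_mul, ← mul_add, ZMod.card, mul_one]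
    by_cases h : k + l = i + j
    · simp only [h, if_true, sum_stdAddChar_mul]
      have h4 : i - j + (k - l) = 0 ↔ i = l ∧ j = k := by
        refine ⟨fun h5 => ?_, fun h5 => by rw [h5.1, h5.2]; ring⟩
        have h6 : i = l := by
          rw [← add_self_inj hodd]
          linear_combination h5 - h
        exact ⟨h6, by linear_combination -h - h6⟩
      simp only [h4]
      split_ifs <;> simp_all
    · have h4 : ¬ (i = l ∧ j = k) := fun h5 => h (by rw [h5.1, h5.2]; ring)
      simp only [h, if_false, Finset.sum_const_zero]
      split_ifs <;> simp_all

end Qudit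

/-! ### Phase-space point operators of composite systems -/

lemma IsPhaseFrame.kronecker {ι κ ι' κ' : Type} [Fintype ι] [DecidableEq ι] [Fintype κ]
    [Fintype ι'] [DecidableEq ι'] [Fintype κ'] {F : κ → Matrix ι ι ℂ} {G : κ' → Matrix ι' ι' ℂ}
    (hF : IsPhaseFrame F) (hG : IsPhaseFrame G) :
    IsPhaseFrame fun u : κ × κ' => F u.1 ⊗ₖ G u.2 where
  isHermitian u := by
    rw [Matrix.IsHermitian, Matrix.conjTranspose_kronecker, hF.isHermitian, hG.isHermitian]
  trace_eq u := by rw [Matrix.trace_kronecker, hF.trace_eq, hG.trace_eq, one_mul]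
  mul_self u := by
    rw [← Matrix.mul_kronecker_mul, hF.mul_self, hG.mul_self, Matrix.one_kronecker_one]
  trace_mul_nonneg u v := by
    rw [← Matrix.mul_kronecker_mul, Matrix.trace_kronecker]
    exact mul_nonneg (hF.trace_mul_nonneg _ _) (hG.trace_mul_nonneg _ _)
  transpose_mem u := by
    obtain ⟨v, hv⟩ := hF.transpose_mem u.1
    obtain ⟨w, hw⟩ := hG.transpose_mem u.2
    refine ⟨(v, w), ?_⟩
    ext i j
    simp only [hv, hw, Matrix.kroneckerMap_apply, Matrix.transpose_apply]
  complete i j k l := by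
    have h : ∀ u : κ × κ', (F u.1 ⊗ₖ G u.2) i j * (F u.1 ⊗ₖ G u.2) k l =
        (F u.1 i.1 j.1 * F u.1 k.1 l.1) * (G u.2 i.2 j.2 * G u.2 k.2 l.2) := fun u => by
      simp only [Matrix.kroneckerMap_apply]
      ring
    simp only [h, Fintype.sum_prod_type, ← Finset.mul_sum, ← Finset.sum_mul, hF.complete,
      hG.complete, Fintype.card_prod, Prod.ext_iff]
    push_cast
    split_ifs <;> simp_all

lemma isPhaseFrame_one : IsPhaseFrame fun _ : Unit => (1 : Matrix Unit Unit ℂ) where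
  isHermitian _ := Matrix.isHermitian_one
  trace_eq _ := by simp
  mul_self _ := by simp
  trace_mul_nonneg _ _ := by simp
  transpose_mem _ := ⟨(), by simp⟩
  complete i j k l := by simp

lemma phaseOp_unit : phaseOp unit = fun _ : Unit => (1 : Matrix Unit Unit ℂ) := by
  have h : heisenbergWeyl unit = fun _ : Unit => (1 : Matrix Unit Unit ℂ) := rfl
  have h0 : phaseOpZero unit = (1 : Matrix Unit Unit ℂ) := by
    rw [phaseOpZero, h]
    change (1 / ((Fintype.card Unit : ℕ) : ℂ)) • ∑ _u : Unit, (1 : Matrix Unit Unit ℂ) = 1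
    simp
  funext u
  rw [phaseOp, h, h0]
  have h1 : (1 : Matrix Unit Unit ℂ) * 1 * (1 : Matrix Unit Unit ℂ).conjTranspose = 1 := by simp
  exact h1

lemma dim_tensor (A B : QSys) : (A.tensor B).dim = A.dim * B.dim :=
  Fintype.card_prod A.Idx B.Idx

lemma phaseOpZero_tensor (A B : QSys) :
    phaseOpZero (A.tensor B) = phaseOpZero A ⊗ₖ phaseOpZero B := by
  have h : (1 / ((A.dim * B.dim : ℕ) : ℂ)) • ∑ u : A.Phase × B.Phase,
      heisenbergWeyl A u.1 ⊗ₖ heisenbergWeyl B u.2 = phaseOpZero A ⊗ₖ phaseOpZero B := by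
    ext i j
    simp only [phaseOpZero, Matrix.smul_apply, Matrix.sum_apply, Matrix.kroneckerMap_apply,
      Fintype.sum_prod_type, ← Finset.mul_sum, ← Finset.sum_mul, smul_eq_mul]
    push_cast
    ring
  rw [← h, ← dim_tensor]
  rfl

lemma phaseOp_tensor (A B : QSys) : phaseOp (A.tensor B) =
    fun u : A.Phase × B.Phase => phaseOp A u.1 ⊗ₖ phaseOp B u.2 := by
  funext u
  rw [phaseOp, phaseOpZero_tensor]
  simp only [phaseOp]
  rw [Matrix.mul_kronecker_mul, Matrix.mul_kronecker_mul, ← Matrix.conjTranspose_kronecker]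
  rfl

theorem isPhaseFrame_phaseOp (A : QSys) : IsPhaseFrame (phaseOp A) := by
  induction A with
  | unit =>
    rw [phaseOp_unit]
    exact isPhaseFrame_one
  | qudit p hp hodd =>
    have : NeZero p := ⟨hp.ne_zero⟩
    rw [phaseOp_qudit]
    exact isPhaseFrame_quditPoint hodd
  | tensor A B hA hB =>
    rw [phaseOp_tensor]
    exact hA.kronecker hB

lemma dim_pos (A : QSys) : 0 < A.dim := by
  induction A with
  | unit => exact Fintype.card_pos (α := Unit)
  | qudit p hp hodd =>
    have : NeZero p := ⟨hp.ne_zero⟩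
    exact Fintype.card_pos (α := ZMod p)
  | tensor A B hA hB =>
    rw [dim_tensor]
    exact Nat.mul_pos hA hB

lemma IsPhaseFrame.sum_trace_smul {ι κ : Type} [Fintype ι] [DecidableEq ι] [Fintype κ]
    {F : κ → Matrix ι ι ℂ} (hF : IsPhaseFrame F) (X : Matrix ι ι ℂ) :
    ∑ u, (F u * X).trace • F u = (Fintype.card ι : ℂ) • X := by
  ext i j
  have h : ∀ u, (F u * X).trace * F u i j = ∑ k, ∑ l, X l k * (F u k l * F u i j) := fun u => by
    simp only [Matrix.trace, Matrix.diag_apply, Matrix.mul_apply, Finset.sum_mul]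
    exact Finset.sum_congr rfl fun k _ => Finset.sum_congr rfl fun l _ => by ring
  simp only [Matrix.sum_apply, Matrix.smul_apply, smul_eq_mul, h]
  rw [Finset.sum_comm]
  simp only [Finset.sum_comm (s := (Finset.univ : Finset κ)), ← Finset.mul_sum, hF.complete]
  simp [mul_comm]

lemma sum_wigner_smul (A : QSys) (X : A.Op) : ∑ u, wigner A X u • phaseOp A u = X := by
  have hd : (A.dim : ℂ) ≠ 0 := Nat.cast_ne_zero.mpr (dim_pos A).ne'
  have h := (isPhaseFrame_phaseOp A).sum_trace_smul X
  simp only [wigner, mul_smul, ← Finset.smul_sum]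
  rw [h, smul_smul, one_div]
  exact (congrArg (· • X) (inv_mul_cancel₀ hd)).trans (one_smul _ _)

lemma sum_wigner (A : QSys) (X : A.Op) : ∑ u, wigner A X u = X.trace := by
  conv_rhs => rw [← sum_wigner_smul A X]
  simp [Matrix.trace_sum, (isPhaseFrame_phaseOp A).trace_eq]

lemma sum_phaseOp (A : QSys) : (1 / (A.dim : ℂ)) • ∑ u, phaseOp A u = 1 := by
  conv_rhs => rw [← sum_wigner_smul A 1]
  simp [wigner, (isPhaseFrame_phaseOp A).trace_eq, Finset.smul_sum]

/-! ### Extending maps by a reference system -/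

section Reference

variable {α β : Type}

/-- Relabelling the reference basis reduces an arbitrary finite reference to `Fin n`. -/
lemma IsCompletelyPositive.posSemidef_idTensor {Φ : Matrix α α ℂ →ₗ[ℂ] Matrix β β ℂ}
    (hΦ : IsCompletelyPositive Φ) {ρ : Type} [Fintype ρ] {M : Matrix (ρ × α) (ρ × α) ℂ}
    (hM : M.PosSemidef) : (idTensor ρ Φ M).PosSemidef := by
  let e := Fintype.equivFin ρ
  have h := (hΦ _ _ (hM.submatrix fun x : Fin (Fintype.card ρ) × α => (e.symm x.1, x.2))).submatrix
    fun x : ρ × β => (e x.1, x.2)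
  convert h using 1
  ext x y
  have hb : blockAt (M.submatrix (fun x : Fin (Fintype.card ρ) × α => (e.symm x.1, x.2))
      fun x => (e.symm x.1, x.2)) (e x.1) (e y.1) = blockAt M x.1 y.1 := by
    ext a b
    simp [blockAt]
  simp only [idTensor, LinearMap.coe_mk, AddHom.coe_mk, Matrix.submatrix_apply, Matrix.of_apply, hb]

lemma blockAt_idTensor {ρ : Type} (Φ : Matrix α α ℂ →ₗ[ℂ] Matrix β β ℂ)
    (M : Matrix (ρ × α) (ρ × α) ℂ) (r s : ρ) :
    blockAt (idTensor ρ Φ M) r s = Φ (blockAt M r s) := rfl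

lemma blockAt_kronecker {ρ : Type} (F : Matrix ρ ρ ℂ) (X : Matrix α α ℂ) (r s : ρ) :
    blockAt (F ⊗ₖ X) r s = F r s • X := rfl

lemma trace_eq_sum_blockAt {ρ : Type} [Fintype ρ] [Fintype α] (M : Matrix (ρ × α) (ρ × α) ℂ) :
    M.trace = ∑ r, (blockAt M r r).trace :=
  Fintype.sum_prod_type _

lemma trace_kronecker_mul {ρ : Type} [Fintype ρ] [Fintype α] (F : Matrix ρ ρ ℂ)
    (G : Matrix α α ℂ) (M : Matrix (ρ × α) (ρ × α) ℂ) :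
    ((F ⊗ₖ G) * M).trace = ∑ r, ∑ s, F r s * (G * blockAt M s r).trace := by
  simp only [Matrix.trace, Matrix.diag_apply, Matrix.mul_apply, Fintype.sum_prod_type,
    Matrix.kroneckerMap_apply, Finset.mul_sum, blockAt, Matrix.of_apply, mul_assoc]
  exact Finset.sum_congr rfl fun r _ => Finset.sum_comm

/-- Heisenberg picture: `G'` is the pull-back of the observable `G` under `Φ`. -/
lemma trace_kronecker_mul_idTensor {ρ : Type} [Fintype ρ] [Fintype α] [Fintype β]
    (Φ : Matrix α α ℂ →ₗ[ℂ] Matrix β β ℂ) (F : Matrix ρ ρ ℂ) {G : Matrix β β ℂ}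
    {G' : Matrix α α ℂ} (h : ∀ X, (G * Φ X).trace = (G' * X).trace)
    (M : Matrix (ρ × α) (ρ × α) ℂ) :
    ((F ⊗ₖ G) * idTensor ρ Φ M).trace = ((F ⊗ₖ G') * M).trace := by
  simp only [trace_kronecker_mul, blockAt_idTensor, h]

lemma IsTracePreserving.idTensor {ρ : Type} [Fintype ρ] [Fintype α] [Fintype β]
    {Φ : Matrix α α ℂ →ₗ[ℂ] Matrix β β ℂ} (hΦ : IsTracePreserving Φ) :
    IsTracePreserving (idTensor ρ Φ) := fun M => by
  simp only [trace_eq_sum_blockAt, blockAt_idTensor, hΦ _]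

lemma IsChannel.idTensor {ρ : Type} [Fintype ρ] [Fintype α] [Fintype β]
    {Φ : Matrix α α ℂ →ₗ[ℂ] Matrix β β ℂ} (hΦ : IsChannel Φ) : IsChannel (idTensor ρ Φ) := by
  refine ⟨fun n M hM => ?_, hΦ.2.idTensor⟩
  exact (hΦ.1.posSemidef_idTensor (hM.submatrix fun x : (Fin n × ρ) × α =>
    (x.1.1, x.1.2, x.2))).submatrix fun x : Fin n × ρ × β => ((x.1, x.2.1), x.2.2)

lemma IsCompletelyPositive.add {Φ Ψ : Matrix α α ℂ →ₗ[ℂ] Matrix β β ℂ}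
    (hΦ : IsCompletelyPositive Φ) (hΨ : IsCompletelyPositive Ψ) :
    IsCompletelyPositive (Φ + Ψ) := fun n M hM => (hΦ n M hM).add (hΨ n M hM)

/-! ### Measure-and-prepare maps -/

/-- The map `X ↦ Tr[P * X] • σ`, as a bilinear function of `P` and `σ`. -/
def measPrep [Fintype α] : Matrix α α ℂ →ₗ[ℂ] Matrix β β ℂ →ₗ[ℂ]
    (Matrix α α ℂ →ₗ[ℂ] Matrix β β ℂ) :=
  LinearMap.mk₂ ℂ
    (fun P σ => ((Matrix.traceLinearMap α ℂ ℂ).comp (LinearMap.mulLeft ℂ P)).smulRight σ)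
    (fun P Q σ => by ext1 X; simp [add_mul, add_smul])
    (fun c P σ => by ext1 X; simp [smul_smul])
    (fun P σ τ => by ext1 X; simp)
    (fun c P σ => by ext1 X; simp [smul_comm c])

@[simp]
lemma measPrep_apply [Fintype α] (P : Matrix α α ℂ) (σ : Matrix β β ℂ) (X : Matrix α α ℂ) :
    measPrep P σ X = (P * X).trace • σ := rfl

open scoped MatrixOrder Matrix.Norms.L2Operator in
lemma posSemidef_trace_mul_blockAt [Fintype α] [DecidableEq α] {ρ : Type} [Fintype ρ]
    [DecidableEq ρ] {P : Matrix α α ℂ} (hP : P.PosSemidef) {M : Matrix (ρ × α) (ρ × α) ℂ}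
    (hM : M.PosSemidef) :
    (Matrix.of fun r s => (P * blockAt M r s).trace : Matrix ρ ρ ℂ).PosSemidef := by
  obtain ⟨C, rfl⟩ : ∃ C : Matrix α α ℂ, P = C.conjTranspose * C :=
    CStarAlgebra.nonneg_iff_eq_star_mul_self.mp hP.nonneg
  -- With `P = C† C`, the matrix in question is the partial trace over `α` of `(1 ⊗ C) M (1 ⊗ C)†`.
  have hZ := hM.mul_mul_conjTranspose_same ((1 : Matrix ρ ρ ℂ) ⊗ₖ C)
  have h := Matrix.posSemidef_sum Finset.univ fun (a : α) _ =>
    hZ.submatrix fun r : ρ => (r, a)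
  convert h using 1
  ext r s
  rw [Matrix.of_apply, mul_assoc, Matrix.trace_mul_comm]
  simp only [Matrix.trace, Matrix.diag_apply, Matrix.mul_apply, Matrix.sum_apply,
    Matrix.submatrix_apply, Matrix.conjTranspose_kronecker, Matrix.conjTranspose_one,
    Fintype.sum_prod_type, Matrix.kroneckerMap_apply, Matrix.one_apply, ite_mul, mul_ite, zero_mul,
    one_mul, mul_zero, Finset.sum_ite_irrel, Finset.sum_const_zero, Finset.sum_ite_eq,
    Finset.sum_ite_eq', Finset.mem_univ, if_true, blockAt, Matrix.of_apply]

lemma isCompletelyPositive_measPrep [Fintype α] [DecidableEq α] [Finite β]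
    {P : Matrix α α ℂ} {σ : Matrix β β ℂ} (hP : P.PosSemidef) (hσ : σ.PosSemidef) :
    IsCompletelyPositive (measPrep P σ) := fun _ _ hM => by
  have := Fintype.ofFinite β
  exact (posSemidef_trace_mul_blockAt hP hM).kronecker hσ

lemma isChannel_measPrep_add [Fintype α] [DecidableEq α] [Fintype β]
    {P Q : Matrix α α ℂ} {σ τ : Matrix β β ℂ} (hP : P.PosSemidef) (hQ : Q.PosSemidef)
    (hPQ : P + Q = 1) (hσ : σ.PosSemidef) (hτ : τ.PosSemidef) (hσ1 : σ.trace = 1)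
    (hτ1 : τ.trace = 1) : IsChannel (measPrep P σ + measPrep Q τ) := by
  refine ⟨(isCompletelyPositive_measPrep hP hσ).add (isCompletelyPositive_measPrep hQ hτ),
    fun M => ?_⟩
  simp only [LinearMap.add_apply, measPrep_apply, Matrix.trace_add, Matrix.trace_smul, hσ1, hτ1,
    smul_eq_mul, mul_one]
  rw [← Matrix.trace_add, ← add_mul, hPQ, one_mul]

end Reference

/-! ### Superchannels and traces -/

/-- The one-dimensional reference `Fin 1` turns the condition on `id ⊗ Ξ` into one on `Ξ` itself. -/
lemma IsSuperchannel.trace_apply {A B C D : QSys} {Ξ : QSuperMap A B C D} (hΞ : IsSuperchannel Ξ)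
    {Φ : QMap A B} (hΦ : IsChannel Φ) (Y : C.Op) : (Ξ Φ Y).trace = Y.trace := by
  have h := (hΞ 1 _ hΦ.idTensor).2 (Matrix.of fun x y => Y x.2 y.2)
  have hs : mapSlice (idTensor (Fin 1) Φ) 0 0 0 0 = Φ := by
    ext1 X
    change Φ (blockAt (Matrix.single (0 : Fin 1) 0 (1 : ℂ) ⊗ₖ X) 0 0) = Φ X
    rw [blockAt_kronecker]
    simp
  have hY : blockAt (Matrix.of fun x y : Fin 1 × C.Idx => Y x.2 y.2) 0 0 = Y := rfl
  rw [trace_eq_sum_blockAt, trace_eq_sum_blockAt] at h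
  simp only [Fin.sum_univ_one] at h
  rw [hY] at h
  rw [← h]
  simp only [Matrix.trace, Matrix.diag_apply, blockAt, idTensorSuper, LinearMap.coe_mk,
    AddHom.coe_mk, Matrix.of_apply, Fin.sum_univ_one, hs]
  rfl

/-- A Hermitian involution has eigenvalues `±1`, so `(1 ± F u) / 2` are projections: `1 ± F u` is
half of its own square. -/
lemma IsPhaseFrame.posSemidef_one_add {ι κ : Type} [Fintype ι] [DecidableEq ι] [Fintype κ]
    {F : κ → Matrix ι ι ℂ} (hF : IsPhaseFrame F) (u : κ) : (1 + F u).PosSemidef := by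
  have h : (1 + F u) = (1 / 2 : ℝ) • ((1 + F u).conjTranspose * (1 + F u)) := by
    rw [Matrix.conjTranspose_add, Matrix.conjTranspose_one, hF.isHermitian, mul_add, add_mul,
      add_mul, hF.mul_self, one_mul, mul_one, one_mul]
    module
  rw [h]
  exact (Matrix.posSemidef_conjTranspose_mul_self _).smul (by norm_num)

lemma IsPhaseFrame.posSemidef_one_sub {ι κ : Type} [Fintype ι] [DecidableEq ι] [Fintype κ]
    {F : κ → Matrix ι ι ℂ} (hF : IsPhaseFrame F) (u : κ) : (1 - F u).PosSemidef := by
  have h : (1 - F u) = (1 / 2 : ℝ) • ((1 - F u).conjTranspose * (1 - F u)) := by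
    rw [Matrix.conjTranspose_sub, Matrix.conjTranspose_one, hF.isHermitian, mul_sub, sub_mul,
      sub_mul, hF.mul_self, one_mul, mul_one, one_mul]
    module
  rw [h]
  exact (Matrix.posSemidef_conjTranspose_mul_self _).smul (by norm_num)

/-! ### The transition operators of the phase space -/

lemma IsSuperchannel.trace_measPrep_one {A B C D : QSys} {Ξ : QSuperMap A B C D}
    (hΞ : IsSuperchannel Ξ) {σ : B.Op} (hσ : σ.PosSemidef) (hσ1 : σ.trace = 1) (Y : C.Op) :
    (Ξ (measPrep 1 σ) Y).trace = Y.trace := by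
  have h := hΞ.trace_apply (isChannel_measPrep_add Matrix.PosSemidef.one Matrix.PosSemidef.zero
    (add_zero (1 : A.Op)) hσ hσ hσ1 hσ1) Y
  simpa using h

/-- Measure the projections `(1 ± A u) / 2` and prepare `σ` or `τ` according to the outcome, or the
other way round. Both are channels, and their difference is `measPrep (A u) (σ - τ)`, so `Ξ` gives
it trace zero. -/
lemma IsSuperchannel.trace_measPrep_phaseOp {A B C D : QSys} {Ξ : QSuperMap A B C D}
    (hΞ : IsSuperchannel Ξ) (u : A.Phase) {σ τ : B.Op} (hσ : σ.PosSemidef) (hσ1 : σ.trace = 1)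
    (hτ : τ.PosSemidef) (hτ1 : τ.trace = 1) (Y : C.Op) :
    (Ξ (measPrep (phaseOp A u) σ) Y).trace = (Ξ (measPrep (phaseOp A u) τ) Y).trace := by
  have hF := isPhaseFrame_phaseOp A
  have hP := (hF.posSemidef_one_add u).smul (show (0 : ℝ) ≤ 1 / 2 by norm_num)
  have hQ := (hF.posSemidef_one_sub u).smul (show (0 : ℝ) ≤ 1 / 2 by norm_num)
  have hPQ : (1 / 2 : ℝ) • (1 + phaseOp A u) + (1 / 2 : ℝ) • (1 - phaseOp A u) = 1 := by module
  have h1 := hΞ.trace_apply (isChannel_measPrep_add hP hQ hPQ hσ hτ hσ1 hτ1) Y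
  have h2 := hΞ.trace_apply (isChannel_measPrep_add hP hQ hPQ hτ hσ hτ1 hσ1) Y
  have hr : ∀ X : A.Op, (1 / 2 : ℝ) • X = (1 / 2 : ℂ) • X := fun X => by
    ext i j
    simp [Matrix.smul_apply]
  simp only [hr, map_add, map_sub, map_smul, LinearMap.add_apply, LinearMap.sub_apply,
    LinearMap.smul_apply, Matrix.trace_add, Matrix.trace_sub, Matrix.trace_smul,
    smul_eq_mul] at h1 h2
  linear_combination h1 - h2

/-- The state proportional to `1 + A v`. -/
def pointState (B : QSys) (v : B.Phase) : B.Op := ((B.dim + 1 : ℝ)⁻¹) • (1 + phaseOp B v)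

lemma posSemidef_pointState (B : QSys) (v : B.Phase) : (pointState B v).PosSemidef :=
  ((isPhaseFrame_phaseOp B).posSemidef_one_add v).smul (by positivity)

lemma trace_one_op (B : QSys) : (1 : B.Op).trace = B.dim := Matrix.trace_one

lemma trace_pointState (B : QSys) (v : B.Phase) : (pointState B v).trace = 1 := by
  have h : ((B.dim : ℂ) + 1) ≠ 0 := Nat.cast_add_one_ne_zero _
  rw [pointState, Matrix.trace_smul, Matrix.trace_add, (isPhaseFrame_phaseOp B).trace_eq,
    trace_one_op, Complex.real_smul]
  push_cast
  exact inv_mul_cancel₀ h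

lemma phaseOp_eq_pointState (B : QSys) (v : B.Phase) :
    phaseOp B v = ((B.dim : ℂ) + 1) • pointState B v - 1 := by
  have h : ((B.dim : ℂ) + 1) ≠ 0 := Nat.cast_add_one_ne_zero _
  ext i j
  simp only [pointState, Matrix.sub_apply, Matrix.smul_apply, Matrix.add_apply, Complex.real_smul,
    smul_eq_mul]
  push_cast
  field_simp
  ring

/-- `A v` need not be a state, but it is the same affine function of the state `pointState B v` for
all `v`, so independence of the prepared state carries over. -/
lemma IsSuperchannel.trace_measPrep_phaseOp_eq {A B C D : QSys} {Ξ : QSuperMap A B C D}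
    (hΞ : IsSuperchannel Ξ) (u : A.Phase) (v w : B.Phase) (Y : C.Op) :
    (Ξ (measPrep (phaseOp A u) (phaseOp B v)) Y).trace =
      (Ξ (measPrep (phaseOp A u) (phaseOp B w)) Y).trace := by
  have h := hΞ.trace_measPrep_phaseOp u (posSemidef_pointState B v) (trace_pointState B v)
    (posSemidef_pointState B w) (trace_pointState B w) Y
  simp only [phaseOp_eq_pointState B, map_sub, map_smul, LinearMap.sub_apply,
    LinearMap.smul_apply, Matrix.trace_sub, Matrix.trace_smul, h]

lemma IsSuperchannel.trace_measPrep_one_phaseOp {A B C D : QSys} {Ξ : QSuperMap A B C D}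
    (hΞ : IsSuperchannel Ξ) (v : B.Phase) (Y : C.Op) :
    (Ξ (measPrep 1 (phaseOp B v)) Y).trace = Y.trace := by
  have hd : (B.dim : ℂ) ≠ 0 := Nat.cast_ne_zero.mpr (dim_pos B).ne'
  have h1 := hΞ.trace_measPrep_one (posSemidef_pointState B v) (trace_pointState B v) Y
  -- `A v` is `d + 1` times `pointState B v` minus `d` times the maximally mixed state; the weights
  -- add up to one.
  have h2 := hΞ.trace_measPrep_one (σ := ((B.dim : ℝ)⁻¹) • (1 : B.Op))
    (Matrix.PosSemidef.one.smul (by positivity)) (by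
      rw [Matrix.trace_smul, trace_one_op, Complex.real_smul]
      push_cast
      exact inv_mul_cancel₀ hd) Y
  have h3 : (1 : B.Op) = (B.dim : ℂ) • (((B.dim : ℝ)⁻¹) • (1 : B.Op)) := by
    ext i j
    simp [Matrix.smul_apply, hd]
  rw [phaseOp_eq_pointState, h3]
  simp only [map_sub, map_smul, LinearMap.sub_apply, LinearMap.smul_apply, Matrix.trace_sub,
    Matrix.trace_smul, h1, h2, smul_eq_mul]
  ring

/-- The map `X ↦ W_X(u) • A v`, whose only non-zero Wigner function value is at `(v|u)`. -/
def transitionMap {A B : QSys} (v : B.Phase) (u : A.Phase) : QMap A B :=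
  measPrep ((1 / (A.dim : ℂ)) • phaseOp A u) (phaseOp B v)

lemma transitionMap_apply {A B : QSys} (v : B.Phase) (u : A.Phase) (X : A.Op) :
    transitionMap v u X = wigner A X u • phaseOp B v := by
  rw [transitionMap, measPrep_apply, wigner, Matrix.smul_mul, Matrix.trace_smul, smul_eq_mul]

lemma sum_wignerMap_smul {A B : QSys} (N : QMap A B) :
    ∑ u, ∑ v, wignerMap N v u • transitionMap v u = N := by
  ext1 X
  conv_rhs => rw [← sum_wigner_smul A X, map_sum]
  rw [LinearMap.sum_apply]
  refine Finset.sum_congr rfl fun u _ => ?_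
  rw [map_smul, ← sum_wigner_smul B (N (phaseOp A u)), LinearMap.sum_apply, Finset.smul_sum]
  refine Finset.sum_congr rfl fun v _ => ?_
  rw [LinearMap.smul_apply, transitionMap_apply, smul_comm]
  rfl

lemma wignerMap_supermap {A B C D : QSys} (Ξ : QSuperMap A B C D) (N : QMap A B) (t : D.Phase)
    (w : C.Phase) : wignerMap (Ξ N) t w =
      ∑ u, ∑ v, wignerMap N v u * wignerMap (Ξ (transitionMap v u)) t w := by
  conv_lhs => rw [← sum_wignerMap_smul N]
  simp only [wignerMap, map_sum, map_smul, LinearMap.sum_apply, LinearMap.smul_apply,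
    Finset.mul_sum, Matrix.trace_sum, Matrix.mul_smul, Matrix.trace_smul,
    smul_eq_mul]
  exact Finset.sum_congr rfl fun u _ => Finset.sum_congr rfl fun v _ => by ring

lemma sum_wignerMap {A B : QSys} (N : QMap A B) (u : A.Phase) :
    ∑ v, wignerMap N v u = (N (phaseOp A u)).trace :=
  sum_wigner B _

lemma IsSuperchannel.sum_wignerMap_transitionMap_eq {A B C D : QSys} {Ξ : QSuperMap A B C D}
    (hΞ : IsSuperchannel Ξ) (u : A.Phase) (v v' : B.Phase) (w : C.Phase) :
    ∑ t, wignerMap (Ξ (transitionMap v u)) t w = ∑ t, wignerMap (Ξ (transitionMap v' u)) t w := by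
  simp only [sum_wignerMap, transitionMap, map_smul, LinearMap.smul_apply, Matrix.trace_smul,
    hΞ.trace_measPrep_phaseOp_eq u v v']

lemma IsSuperchannel.sum_sum_wignerMap_transitionMap {A B C D : QSys} {Ξ : QSuperMap A B C D}
    (hΞ : IsSuperchannel Ξ) (v : B.Phase) (w : C.Phase) :
    ∑ u : A.Phase, ∑ t, wignerMap (Ξ (transitionMap v u)) t w = 1 := by
  have h : ∑ u : A.Phase, transitionMap v u = measPrep (1 : A.Op) (phaseOp B v) := by
    simp only [transitionMap, ← LinearMap.sum_apply, ← map_sum, ← Finset.smul_sum, sum_phaseOp]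
  simp only [sum_wignerMap, ← Matrix.trace_sum, ← LinearMap.sum_apply, ← map_sum, h]
  rw [hΞ.trace_measPrep_one_phaseOp, (isPhaseFrame_phaseOp C).trace_eq]

/-- Monotonicity of mana, from the non-negativity of the Wigner function of the supermap. -/
theorem IsSuperchannel.mana_le {A B C D : QSys} {Ξ : QSuperMap A B C D} (hΞ : IsSuperchannel Ξ)
    (hpos : ∀ (u : A.Phase) (v : B.Phase) t w, 0 ≤ wignerMap (Ξ (transitionMap v u)) t w)
    (N : QMap A B) : mana (Ξ N) ≤ mana N := by
  refine ENNReal.log_monotone (ENNReal.ofReal_le_ofReal (ciSup_le fun w => ?_))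
  set m := ⨆ u : A.Phase, ∑ v : B.Phase, ‖wignerMap N v u‖
  have hm : ∀ u, ∑ v, ‖wignerMap N v u‖ ≤ m := fun u => le_ciSup (Finite.bddAbove_range
    fun u : A.Phase => ∑ v : B.Phase, ‖wignerMap N v u‖) u
  -- The mass of the kernel does not depend on `v`, so the origin of `B` is just a representative;
  -- `q` is a probability distribution on the phase space of `A`.
  let q : A.Phase → ℝ := fun u => ∑ t, ‖wignerMap (Ξ (transitionMap (origin B) u)) t w‖
  have hn : ∀ u v t, ((‖wignerMap (Ξ (transitionMap v u)) t w‖ : ℝ) : ℂ) =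
      wignerMap (Ξ (transitionMap v u)) t w := fun u v t =>
    Complex.norm_of_nonneg' (hpos u v t w)
  have hq : ∀ u v, ∑ t, ‖wignerMap (Ξ (transitionMap v u)) t w‖ = q u := fun u v => by
    refine Complex.ofReal_injective ?_
    simp only [q, Complex.ofReal_sum, hn]
    exact hΞ.sum_wignerMap_transitionMap_eq u v (origin B) w
  have hq1 : ∑ u, q u = 1 := by
    refine Complex.ofReal_injective ?_
    simp only [q, Complex.ofReal_sum, hn, Complex.ofReal_one]
    exact hΞ.sum_sum_wignerMap_transitionMap (origin B) w
  calc ∑ t, ‖wignerMap (Ξ N) t w‖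
      ≤ ∑ t, ∑ u, ∑ v, ‖wignerMap N v u‖ * ‖wignerMap (Ξ (transitionMap v u)) t w‖ := by
        refine Finset.sum_le_sum fun t _ => ?_
        rw [wignerMap_supermap]
        refine (norm_sum_le _ _).trans (Finset.sum_le_sum fun u _ => ?_)
        exact (norm_sum_le _ _).trans_eq (Finset.sum_congr rfl fun v _ => norm_mul _ _)
    _ = ∑ u, (∑ v, ‖wignerMap N v u‖) * q u := by
        rw [Finset.sum_comm]
        refine Finset.sum_congr rfl fun u _ => ?_
        rw [Finset.sum_comm, Finset.sum_mul]
        exact Finset.sum_congr rfl fun v _ => by rw [← Finset.mul_sum, hq]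
    _ ≤ ∑ u, m * q u := Finset.sum_le_sum fun u _ =>
        mul_le_mul_of_nonneg_right (hm u) (Finset.sum_nonneg fun t _ => norm_nonneg _)
    _ = m := by rw [← Finset.mul_sum, hq1, mul_one]

/-! ### Completely positive Wigner preserving maps have non-negative Wigner functions -/

/-- The maximally entangled state. -/
def maxEntangled (A : QSys) : Matrix (A.Idx × A.Idx) (A.Idx × A.Idx) ℂ :=
  Matrix.of fun x y => (1 / (A.dim : ℂ)) * ((if x.1 = x.2 then 1 else 0) *
    (if y.1 = y.2 then 1 else 0))

lemma blockAt_maxEntangled (A : QSys) (r s : A.Idx) :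
    blockAt (maxEntangled A) r s = (1 / (A.dim : ℂ)) • Matrix.single r s 1 := by
  ext i j
  simp only [blockAt, maxEntangled, Matrix.of_apply, Matrix.smul_apply, Matrix.single_apply,
    smul_eq_mul]
  split_ifs <;> simp_all

/-- The maximally entangled state converts an operator on the reference into its transpose on the
other side. -/
lemma trace_kronecker_mul_maxEntangled (A : QSys) (F G : A.Op) :
    ((F ⊗ₖ G) * maxEntangled A).trace = (1 / (A.dim : ℂ)) * (G * F.transpose).trace := by
  refine (trace_kronecker_mul F G (maxEntangled A)).trans ?_
  simp only [blockAt_maxEntangled, Matrix.mul_smul, Matrix.trace_smul, smul_eq_mul,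
    Matrix.trace_mul_single, MulOpposite.op_one, one_smul]
  simp only [Matrix.trace, Matrix.diag_apply, Matrix.mul_apply, Matrix.transpose_apply,
    Finset.mul_sum]
  exact Finset.sum_congr rfl fun r _ => Finset.sum_congr rfl fun s _ => by ring

lemma wigner_tensor (A B : QSys) (X : Matrix (A.Idx × B.Idx) (A.Idx × B.Idx) ℂ) (u : A.Phase)
    (v : B.Phase) : wigner (A.tensor B) X ((u, v) : A.Phase × B.Phase) =
      (1 / ((A.tensor B).dim : ℂ)) * ((phaseOp A u ⊗ₖ phaseOp B v) * X).trace := by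
  unfold wigner
  rw [phaseOp_tensor]
  rfl

lemma one_div_dim_nonneg (A : QSys) : (0 : ℂ) ≤ 1 / (A.dim : ℂ) := by
  rw [one_div, ← Complex.ofReal_natCast, ← Complex.ofReal_inv, Complex.zero_le_real]
  positivity

/-- Its Wigner values are non-negative multiples of `Tr[A v * (A u)ᵀ]`, and transposes of point
operators are point operators. -/
lemma isWignerPositiveState_maxEntangled (A : QSys) :
    IsWignerPositiveState (A.tensor A) (maxEntangled A) := by
  have hd : (A.dim : ℂ) ≠ 0 := Nat.cast_ne_zero.mpr (dim_pos A).ne'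
  refine ⟨?_, ?_, ?_⟩
  · let f : A.Idx × A.Idx → ℂ := fun x => if x.1 = x.2 then 1 else 0
    have h : maxEntangled A = (1 / (A.dim : ℂ)) • Matrix.vecMulVec f (star f) := by
      ext x y
      simp [maxEntangled, Matrix.vecMulVec_apply, f, apply_ite star]
    rw [h]
    exact (Matrix.posSemidef_vecMulVec_self_star f).smul (one_div_dim_nonneg A)
  · refine (trace_eq_sum_blockAt (maxEntangled A)).trans ?_
    simp only [blockAt_maxEntangled, Matrix.trace_smul, Matrix.trace_single_eq_same, smul_eq_mul,
      mul_one, Finset.sum_const, Finset.card_univ, nsmul_eq_mul]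
    exact mul_one_div_cancel hd
  · rintro ⟨u, v⟩
    obtain ⟨u', hu⟩ := (isPhaseFrame_phaseOp A).transpose_mem u
    refine le_of_le_of_eq ?_ (wigner_tensor A A (maxEntangled A) u v).symm
    rw [trace_kronecker_mul_maxEntangled, ← hu]
    exact mul_nonneg (one_div_dim_nonneg _) (mul_nonneg (one_div_dim_nonneg _)
      ((isPhaseFrame_phaseOp A).trace_mul_nonneg _ _))

lemma dim_mul_one_div (A : QSys) : (A.dim : ℂ) * (1 / (A.dim : ℂ)) = 1 :=
  mul_one_div_cancel (Nat.cast_ne_zero.mpr (dim_pos A).ne')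

lemma dim_nonneg (A : QSys) : (0 : ℂ) ≤ (A.dim : ℂ) := by
  rw [← Complex.ofReal_natCast, Complex.zero_le_real]
  positivity

lemma nonneg_of_one_div_dim_mul (A : QSys) {z : ℂ} (h : 0 ≤ 1 / (A.dim : ℂ) * z) : 0 ≤ z := by
  have h' := mul_nonneg (dim_nonneg A) h
  rwa [← mul_assoc, dim_mul_one_div, one_mul] at h'

/-- The Wigner function of the Choi state of `Φ`, taken at the transposed point `u'` on the
reference, is a positive multiple of that of `Φ` at `(v|u)`. -/
lemma IsCPWP.wignerMap_nonneg {A B : QSys} {Φ : QMap A B} (hΦ : IsCPWP Φ) (v : B.Phase)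
    (u : A.Phase) : 0 ≤ wignerMap Φ v u := by
  obtain ⟨u', hu⟩ := (isPhaseFrame_phaseOp A).transpose_mem u
  have h := ((hΦ.2 A _ (isWignerPositiveState_maxEntangled A)).2.2
    ((u', v) : A.Phase × B.Phase)).trans_eq
      (wigner_tensor A B (idTensor A.Idx Φ (maxEntangled A)) u' v)
  have h1 := nonneg_of_one_div_dim_mul _ h
  have h2 : ((phaseOp A u' ⊗ₖ phaseOp B v) * idTensor A.Idx Φ (maxEntangled A)).trace =
      (1 / (A.dim : ℂ)) * (phaseOp B v * Φ (phaseOp A u)).trace := by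
    rw [trace_kronecker_mul]
    have h3 : phaseOp A u = ∑ r, ∑ s, phaseOp A u' r s • Matrix.single s r (1 : ℂ) := by
      have ht : phaseOp A u = (phaseOp A u').transpose := by rw [hu, Matrix.transpose_transpose]
      conv_lhs => rw [ht, Matrix.matrix_eq_sum_single (phaseOp A u').transpose]
      rw [Finset.sum_comm]
      simp [Matrix.smul_single]
    conv_rhs => rw [h3]
    simp only [blockAt_idTensor, blockAt_maxEntangled, map_smul, map_sum, Matrix.mul_smul,
      Matrix.trace_sum, Matrix.trace_smul, smul_eq_mul, Finset.mul_sum]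
    exact Finset.sum_congr rfl fun r _ => Finset.sum_congr rfl fun s _ => by ring
  exact mul_nonneg (one_div_dim_nonneg B) (nonneg_of_one_div_dim_mul A (h2 ▸ h1))

/-! ### The exchange channel -/

section Exchange

variable {α β : Type} [Fintype α] [Fintype β] [DecidableEq β]

/-- The channel from `(α ⊗ β) ⊗ α` to `(α ⊗ β) ⊗ β` that discards the first factor, moves the
other two to the places of the same type, and prepares the maximally mixed state in the remaining
place. -/
def exchangeMap (α β : Type) [Fintype α] [Fintype β] [DecidableEq β] :
    Matrix ((α × β) × α) ((α × β) × α) ℂ →ₗ[ℂ] Matrix ((α × β) × β) ((α × β) × β) ℂ where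
  toFun X := Matrix.of fun i j => (if i.1.2 = j.1.2 then 1 / (Fintype.card β : ℂ) else 0) *
    ∑ x, X ((x, i.2), i.1.1) ((x, j.2), j.1.1)
  map_add' X Y := by
    ext i j
    simp [Finset.sum_add_distrib, mul_add]
  map_smul' c X := by
    ext i j
    simp only [Matrix.smul_apply, Matrix.of_apply, smul_eq_mul, ← Finset.mul_sum,
      RingHom.id_apply]
    ring

lemma exchangeMap_kronecker (F G : Matrix α α ℂ) (H : Matrix β β ℂ) :
    exchangeMap α β ((F ⊗ₖ H) ⊗ₖ G) =
      (F.trace / (Fintype.card β : ℂ)) • ((G ⊗ₖ (1 : Matrix β β ℂ)) ⊗ₖ H) := by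
  ext i j
  simp only [exchangeMap, LinearMap.coe_mk, AddHom.coe_mk, Matrix.of_apply,
    Matrix.kroneckerMap_apply, Matrix.smul_apply, Matrix.one_apply, smul_eq_mul,
    ← Finset.sum_mul, Matrix.trace, Matrix.diag_apply]
  split_ifs
  · ring
  · ring

lemma isCompletelyPositive_exchangeMap : IsCompletelyPositive (exchangeMap α β) := fun n M hM => by
  have hZ := Matrix.posSemidef_sum Finset.univ fun (x : α) _ =>
    hM.submatrix fun r : Fin n × β × α => (r.1, ((x, r.2.1), r.2.2))
  have hc : (0 : ℝ) ≤ 1 / (Fintype.card β : ℝ) := by positivity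
  have he : idTensor (Fin n) (exchangeMap α β) M =
      ((∑ x, M.submatrix (fun r : Fin n × β × α => (r.1, ((x, r.2.1), r.2.2)))
        fun r => (r.1, ((x, r.2.1), r.2.2))) ⊗ₖ
          ((1 / (Fintype.card β : ℝ)) • (1 : Matrix β β ℂ))).submatrix
        (fun i : Fin n × (α × β) × β => ((i.1, i.2.2, i.2.1.1), i.2.1.2))
        fun i => ((i.1, i.2.2, i.2.1.1), i.2.1.2) := by
    ext i j
    simp only [idTensor, exchangeMap, blockAt, LinearMap.coe_mk, AddHom.coe_mk, Matrix.of_apply,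
      Matrix.submatrix_apply, Matrix.kroneckerMap_apply, Matrix.sum_apply, Matrix.smul_apply,
      Matrix.one_apply, Complex.real_smul]
    split_ifs <;> simp [mul_comm]
  rw [he]
  exact (hZ.kronecker (Matrix.PosSemidef.one.smul hc)).submatrix _

lemma isTracePreserving_exchangeMap [Nonempty β] : IsTracePreserving (exchangeMap α β) :=
  fun X => by
  have hd : (Fintype.card β : ℂ) ≠ 0 := Nat.cast_ne_zero.mpr Fintype.card_ne_zero
  simp only [Matrix.trace, Matrix.diag_apply, Fintype.sum_prod_type, exchangeMap,
    LinearMap.coe_mk, AddHom.coe_mk, Matrix.of_apply, if_true, ← Finset.mul_sum,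
    Finset.sum_const, Finset.card_univ, nsmul_eq_mul]
  rw [← mul_assoc, one_div, inv_mul_cancel₀ hd, one_mul]
  exact Finset.sum_comm.trans ((Finset.sum_congr rfl fun _ _ => Finset.sum_comm).trans
    Finset.sum_comm)

lemma isHermiticityPreserving_exchangeMap : IsHermiticityPreserving (exchangeMap α β) :=
  fun X hX => by
  ext i j
  simp only [Matrix.conjTranspose_apply, exchangeMap, LinearMap.coe_mk, AddHom.coe_mk,
    Matrix.of_apply, star_mul', star_sum, hX.apply, eq_comm (a := i.1.2)]
  split_ifs <;> simp

/-- Two functionals on a threefold tensor product agree if they agree on product operators. -/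
lemma linearMap_ext_kronecker {α β γ V : Type} [Fintype α] [Fintype β] [Fintype γ]
    [AddCommMonoid V] [Module ℂ V]
    {f g : Matrix ((α × β) × γ) ((α × β) × γ) ℂ →ₗ[ℂ] V}
    (h : ∀ (F : Matrix α α ℂ) (H : Matrix β β ℂ) (G : Matrix γ γ ℂ),
      f ((F ⊗ₖ H) ⊗ₖ G) = g ((F ⊗ₖ H) ⊗ₖ G)) : f = g := by
  classical
  refine Matrix.ext_linearMap _ fun i j => LinearMap.ext_ring ?_
  have h1 := h (Matrix.single i.1.1 j.1.1 1) (Matrix.single i.1.2 j.1.2 1)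
    (Matrix.single i.2 j.2 1)
  rw [Matrix.single_kronecker_single, Matrix.single_kronecker_single] at h1
  simpa using h1

/-- The adjoint of the exchange channel on product observables; positivity of output Wigner
functions is read off from it. -/
lemma trace_kronecker_mul_exchangeMap [DecidableEq α] (P : Matrix α α ℂ) (Q S : Matrix β β ℂ)
    (X : Matrix ((α × β) × α) ((α × β) × α) ℂ) :
    (((P ⊗ₖ Q) ⊗ₖ S) * exchangeMap α β X).trace =
      (((Q.trace / (Fintype.card β : ℂ)) • (((1 : Matrix α α ℂ) ⊗ₖ S) ⊗ₖ P)) * X).trace := by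
  have h : (Matrix.traceLinearMap _ ℂ ℂ ∘ₗ LinearMap.mulLeft ℂ ((P ⊗ₖ Q) ⊗ₖ S)) ∘ₗ
      exchangeMap α β = Matrix.traceLinearMap _ ℂ ℂ ∘ₗ LinearMap.mulLeft ℂ
        ((Q.trace / (Fintype.card β : ℂ)) • (((1 : Matrix α α ℂ) ⊗ₖ S) ⊗ₖ P)) := by
    refine linearMap_ext_kronecker fun F H G => ?_
    simp only [LinearMap.comp_apply, LinearMap.mulLeft_apply, Matrix.traceLinearMap_apply,
      exchangeMap_kronecker, Matrix.mul_smul, Matrix.smul_mul, ← Matrix.mul_kronecker_mul,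
      Matrix.trace_smul, Matrix.trace_kronecker, mul_one, one_mul, smul_eq_mul]
    ring
  exact LinearMap.congr_fun h X

end Exchange

/-! ### Supermaps with a reference system -/

/-- Inserting `F` and measuring `P` on the reference commutes with the supermap: `id ⊗ Ξ` acts
component by component, so by linearity `Ξ` sees only the slice `Φ` of `N`. -/
lemma trace_kronecker_mul_idTensorSuper {α β γ δ ρ : Type} [Fintype γ] [Fintype δ]
    [Fintype ρ] [DecidableEq ρ]
    (Ξ : (Matrix α α ℂ →ₗ[ℂ] Matrix β β ℂ) →ₗ[ℂ] (Matrix γ γ ℂ →ₗ[ℂ] Matrix δ δ ℂ))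
    {N : Matrix (ρ × α) (ρ × α) ℂ →ₗ[ℂ] Matrix (ρ × β) (ρ × β) ℂ} {P F : Matrix ρ ρ ℂ}
    {Φ : Matrix α α ℂ →ₗ[ℂ] Matrix β β ℂ}
    (h : ∀ X, ∑ r, ∑ s, P r s • blockAt (N (F ⊗ₖ X)) s r = Φ X)
    (S : Matrix δ δ ℂ) (Y : Matrix γ γ ℂ) :
    ((P ⊗ₖ S) * idTensorSuper Ξ N (F ⊗ₖ Y)).trace = (S * Ξ Φ Y).trace := by
  have hb : ∀ r s, blockAt (idTensorSuper Ξ N (F ⊗ₖ Y)) s r =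
      ∑ k, ∑ l, F k l • Ξ (mapSlice N k l s r) Y := fun r s => by
    ext i j
    simp only [blockAt, idTensorSuper, LinearMap.coe_mk, AddHom.coe_mk, Matrix.of_apply,
      Matrix.sum_apply, Matrix.smul_apply]
    refine Finset.sum_congr rfl fun k _ => Finset.sum_congr rfl fun l _ => ?_
    have hF : (Matrix.of fun a a' => (F ⊗ₖ Y) (k, a) (l, a')) = F k l • Y := rfl
    rw [hF, map_smul]
    rfl
  have hΦ : Φ = ∑ r, ∑ s, P r s • ∑ k, ∑ l, F k l • mapSlice N k l s r := by
    ext1 X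
    rw [← h X]
    simp only [LinearMap.sum_apply, LinearMap.smul_apply]
    refine Finset.sum_congr rfl fun r _ => Finset.sum_congr rfl fun s _ => congrArg _ ?_
    have hF : F ⊗ₖ X = ∑ k, ∑ l, F k l • (Matrix.single k l (1 : ℂ) ⊗ₖ X) := by
      ext i j
      simp [Matrix.sum_apply, Matrix.single_apply, ite_and]
    rw [hF]
    ext i j
    simp only [map_sum, map_smul, blockAt, Matrix.of_apply, Matrix.sum_apply, Matrix.smul_apply,
      mapSlice, LinearMap.coe_mk, AddHom.coe_mk]
  rw [trace_kronecker_mul, hΦ]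
  simp only [hb, map_sum, map_smul, LinearMap.sum_apply, LinearMap.smul_apply, Matrix.mul_sum,
    Matrix.mul_smul, Matrix.trace_sum, Matrix.trace_smul, smul_eq_mul]

/-- The slice of the exchange channel: its input `X` lands in the reference, where `P` measures it,
while the inserted `H` becomes the output. `F` and `Q` meet only a trace and a maximally mixed
state, so they contribute scalars. -/
lemma sum_smul_blockAt_exchangeMap {α β : Type} [Fintype α] [Fintype β] [DecidableEq β]
    (P F : Matrix α α ℂ) (Q H : Matrix β β ℂ) (X : Matrix α α ℂ) :
    ∑ r, ∑ s, (P ⊗ₖ Q) r s • blockAt (exchangeMap α β ((F ⊗ₖ H) ⊗ₖ X)) s r =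
      measPrep ((F.trace * Q.trace / (Fintype.card β : ℂ)) • P) H X := by
  have h : ∑ r, ∑ s, (P ⊗ₖ Q) r s * (X ⊗ₖ (1 : Matrix β β ℂ)) s r = (P * X).trace * Q.trace := by
    rw [← mul_one Q, ← Matrix.trace_kronecker, Matrix.mul_kronecker_mul, mul_one]
    rfl
  have hb : ∀ r s, blockAt (exchangeMap α β ((F ⊗ₖ H) ⊗ₖ X)) s r =
      (F.trace / (Fintype.card β : ℂ) * (X ⊗ₖ (1 : Matrix β β ℂ)) s r) • H := fun r s => by
    rw [exchangeMap_kronecker, mul_smul, ← blockAt_kronecker]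
    rfl
  simp only [hb, smul_smul, ← Finset.sum_smul]
  rw [measPrep_apply, Matrix.smul_mul, Matrix.trace_smul, smul_eq_mul]
  congr 1
  have h2 : F.trace * Q.trace / (Fintype.card β : ℂ) * (P * X).trace =
      F.trace / (Fintype.card β : ℂ) * ((P * X).trace * Q.trace) := by ring
  rw [h2, ← h]
  simp only [Finset.mul_sum]
  exact Finset.sum_congr rfl fun r _ => Finset.sum_congr rfl fun s _ => by ring

/-! ### Non-negativity of the Wigner function of a supermap -/

lemma nonempty_idx (A : QSys) : Nonempty A.Idx := Fintype.card_pos_iff.mp (dim_pos A)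

/-- The exchange channel, between composite systems. -/
def exchangeQMap (A B : QSys) : QMap ((A.tensor B).tensor A) ((A.tensor B).tensor B) :=
  exchangeMap A.Idx B.Idx

lemma isChannel_exchangeQMap (A B : QSys) : IsChannel (exchangeQMap A B) :=
  have := nonempty_idx B
  ⟨isCompletelyPositive_exchangeMap (α := A.Idx) (β := B.Idx),
    isTracePreserving_exchangeMap (α := A.Idx) (β := B.Idx)⟩

lemma phaseOp_tensor_tensor (A B C : QSys) (a : A.Phase) (b : B.Phase) (c : C.Phase) :
    phaseOp ((A.tensor B).tensor C) (((a, b), c) : (A.Phase × B.Phase) × C.Phase) =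
      (phaseOp A a ⊗ₖ phaseOp B b) ⊗ₖ phaseOp C c := by
  rw [phaseOp_tensor, phaseOp_tensor]
  rfl

lemma wigner_tensor_tensor (R A B C : QSys) (r : R.Phase) (a : A.Phase) (b : B.Phase) (c : C.Phase)
    (M : Matrix (R.Idx × (A.Idx × B.Idx) × C.Idx) (R.Idx × (A.Idx × B.Idx) × C.Idx) ℂ) :
    wigner (R.tensor ((A.tensor B).tensor C)) M
        ((r, ((a, b), c)) : R.Phase × (A.Phase × B.Phase) × C.Phase) =
      (1 / ((R.tensor ((A.tensor B).tensor C)).dim : ℂ)) *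
        ((phaseOp R r ⊗ₖ ((phaseOp A a ⊗ₖ phaseOp B b) ⊗ₖ phaseOp C c)) * M).trace := by
  rw [← phaseOp_tensor_tensor]
  exact wigner_tensor R ((A.tensor B).tensor C) M r ((a, b), c)

/-- Writing the identity on the discarded factor as an average of point operators shows that the
adjoint of the exchange channel sends point operators to non-negative combinations of point
operators. -/
lemma trace_exchangeQMap (R A B : QSys) (r : R.Phase) (a : A.Phase) (b b' : B.Phase)
    (M : Matrix (R.Idx × (A.Idx × B.Idx) × A.Idx) (R.Idx × (A.Idx × B.Idx) × A.Idx) ℂ) :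
    ((phaseOp R r ⊗ₖ ((phaseOp A a ⊗ₖ phaseOp B b) ⊗ₖ phaseOp B b')) *
        idTensor R.Idx (exchangeMap A.Idx B.Idx) M).trace =
      (1 / (B.dim : ℂ)) * ((1 / (A.dim : ℂ)) * ∑ x,
        ((phaseOp R r ⊗ₖ ((phaseOp A x ⊗ₖ phaseOp B b') ⊗ₖ phaseOp A a)) * M).trace) := by
  have h1 : ((phaseOp B b).trace / (Fintype.card B.Idx : ℂ)) •
      (((1 : A.Op) ⊗ₖ phaseOp B b') ⊗ₖ phaseOp A a) =
      (1 / (B.dim : ℂ)) • (1 / (A.dim : ℂ)) • ∑ x,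
        ((phaseOp A x ⊗ₖ phaseOp B b') ⊗ₖ phaseOp A a) := by
    rw [(isPhaseFrame_phaseOp B).trace_eq, ← sum_phaseOp A]
    ext i j
    simp only [Matrix.smul_apply, Matrix.sum_apply, Matrix.kroneckerMap_apply, smul_eq_mul,
      Finset.mul_sum, Finset.sum_mul, QSys.dim]
    exact Finset.sum_congr rfl fun _ _ => by ring
  rw [trace_kronecker_mul_idTensor _ _ (trace_kronecker_mul_exchangeMap _ _ _), h1]
  have h2 : phaseOp R r ⊗ₖ ((1 / (B.dim : ℂ)) • (1 / (A.dim : ℂ)) • ∑ x,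
        ((phaseOp A x ⊗ₖ phaseOp B b') ⊗ₖ phaseOp A a)) =
      (1 / (B.dim : ℂ)) • (1 / (A.dim : ℂ)) • ∑ x,
        (phaseOp R r ⊗ₖ ((phaseOp A x ⊗ₖ phaseOp B b') ⊗ₖ phaseOp A a)) := by
    ext i j
    simp only [Matrix.smul_apply, Matrix.sum_apply, Matrix.kroneckerMap_apply, smul_eq_mul,
      Finset.mul_sum]
    exact Finset.sum_congr rfl fun _ _ => by ring
  rw [h2, Matrix.smul_mul, Matrix.smul_mul, Matrix.trace_smul, Matrix.trace_smul, Finset.sum_mul,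
    Matrix.trace_sum, smul_eq_mul, smul_eq_mul]

lemma isCPWP_exchangeQMap (A B : QSys) : IsCPWP (exchangeQMap A B) := by
  refine ⟨isHermiticityPreserving_exchangeMap (α := A.Idx) (β := B.Idx), fun R M hM => ?_⟩
  refine ⟨(isChannel_exchangeQMap A B).1.posSemidef_idTensor hM.1,
    ((isChannel_exchangeQMap A B).2.idTensor (ρ := R.Idx) M).trans hM.2.1, ?_⟩
  rintro ⟨r, ⟨a, b⟩, b'⟩
  refine le_of_le_of_eq ?_ (wigner_tensor_tensor R A B B r a b b'
    (idTensor R.Idx (exchangeMap A.Idx B.Idx) M)).symm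
  refine mul_nonneg (one_div_dim_nonneg _) (le_of_le_of_eq ?_
    (trace_exchangeQMap R A B r a b b' M).symm)
  refine mul_nonneg (one_div_dim_nonneg _) (mul_nonneg (one_div_dim_nonneg _)
    (Finset.sum_nonneg fun x _ => ?_))
  have h := (hM.2.2 ((r, ((x, b'), a)) : R.Phase × (A.Phase × B.Phase) × A.Phase)).trans_eq
    (wigner_tensor_tensor R A B A r x b' a M)
  exact nonneg_of_one_div_dim_mul _ h

lemma IsCPWPSuperchannel.wignerMap_transitionMap_nonneg {A B C D : QSys} {Ξ : QSuperMap A B C D}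
    (hΞ : IsCPWPSuperchannel Ξ) (u : A.Phase) (v : B.Phase) (t : D.Phase) (w : C.Phase) :
    0 ≤ wignerMap (Ξ (transitionMap v u)) t w := by
  -- On the reference, `(u, v)` is taken on both sides. The measured `A u` and the inserted `A v`
  -- select the transition; the other two operators matter only through their trace, which is one.
  have h := (hΞ.2 (A.tensor B) _ (isChannel_exchangeQMap A B)
    (isCPWP_exchangeQMap A B)).wignerMap_nonneg
      (((u, v), t) : (A.Phase × B.Phase) × D.Phase) (((u, v), w) : (A.Phase × B.Phase) × C.Phase)
  unfold wignerMap at h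
  rw [phaseOp_tensor_tensor, phaseOp_tensor_tensor] at h
  have h1 := (nonneg_of_one_div_dim_mul _ h).trans_eq
    (trace_kronecker_mul_idTensorSuper Ξ (sum_smul_blockAt_exchangeMap (phaseOp A u) (phaseOp A u)
      (phaseOp B v) (phaseOp B v)) (phaseOp D t) (phaseOp C w))
  rw [(isPhaseFrame_phaseOp A).trace_eq, (isPhaseFrame_phaseOp B).trace_eq, mul_one, map_smul,
    LinearMap.smul_apply, map_smul, LinearMap.smul_apply, Matrix.mul_smul, Matrix.trace_smul] at h1
  have h2 := nonneg_of_one_div_dim_mul B h1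
  rw [wignerMap, transitionMap, map_smul, LinearMap.smul_apply, map_smul, LinearMap.smul_apply,
    Matrix.mul_smul, Matrix.trace_smul]
  exact mul_nonneg (one_div_dim_nonneg D) (mul_nonneg (one_div_dim_nonneg A) h2)

end

theorem mainTheorem3 (A B C D : QSys) (Ξ : QSuperMap A B C D) (hΞ : IsCPWPSuperchannel Ξ)
    (N : QMap A B) (hN : IsCompletelyPositive N) :
    mana (Ξ N) ≤ mana N := by
  exact hΞ.1.mana_le hΞ.wignerMap_transitionMap_nonneg N
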